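/- Let $0\le q<1$, put $[k]_q!=\prod_{j=1}^{k}(1+q+\cdots+q^{j-1})$ and $E_q(\zeta)=\sum_{k\ge 0}\zeta^k/[k]_q!$ (convergent for $|\zeta|<\frac1{1-q}$), and let $\mathbf H_{2,q}$ be the reproducing kernel Hilbert space of functions on the disk $|z|<\frac{1}{\sqrt{1-q}}$ with reproducing kernel $E_q(z\overline w)$. Let $\mathbf H_2(\mathbb D)$ be the Hardy space of the open unit disk $\mathbb D$, i.e. the reproducing kernel Hilbert space with kernel $\frac1{1-z\overline w}$. A Schur multiplier of a reproducing kernel Hilbert space of functions on a disk is a function $s$, analytic in that disk, for which the operator $M_s\colon f\mapsto sf$ is a contraction ($\|M_s\|\le 1$) from the space into itself. (1) Let $s$ be analytic in $|z|<\frac1{\sqrt{1-q}}$. Then $M_s$ is a contractive operator from $\mathbf H_{2,q}$ into itself if and only if $\sigma(z)=s\left(\frac{z}{\sqrt{1-q}}\right)$ is a Schur function, i.e. is analytic in the open unit disk and satisfies $|\sigma(z)|\le 1$ there. (2) The Schur multipliers of $\mathbf H_{2,q}$ are exactly the functions $z\mapsto\sigma(\sqrt{1-q}\,z)$, $|z|<\frac{1}{\sqrt{1-q}}$,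 where $\sigma$ is a Schur multiplier of $\mathbf H_2(\mathbb D)$. -/

import Mathlib

noncomputable section

open ComplexConjugate Filter Topology

/-- The `q`-factorial `[k]_q! = 1 · (1 + q) · (1 + q + q²) ⋯ (1 + q + ⋯ + q^(k-1))`. -/
def qFactorial (q : ℝ) (k : ℕ) : ℝ :=
  ∏ j ∈ Finset.range k, ∑ i ∈ Finset.range (j + 1), q ^ i

/-- The `q`-exponential `E_q(ζ) = ∑ ζ^k / [k]_q!`; the series converges for `|ζ| < 1 / (1 - q)`. -/
def qExp (q : ℝ) (ζ : ℂ) : ℂ := ∑' k : ℕ, ζ ^ k / (qFactorial q k : ℂ)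

/-- The open disk of radius `R` about the origin, as a type. -/
abbrev Disk (R : ℝ) : Type := Metric.ball (0 : ℂ) R

/-- The radius `1 / √(1 - q)` of the disk on which the elements of `H_{2,q}` live. -/
def qRadius (q : ℝ) : ℝ := 1 / √(1 - q)

/-- A scalar kernel, seen as a kernel with values in the operators on `ℂ`
(`k` acts as multiplication by `k z w`). -/
def scalarKernel {X : Type} (k : X → X → ℂ) : Matrix X X (ℂ →L[ℂ] ℂ) :=
  .of fun z w ↦ k z w • ContinuousLinearMap.id ℂ ℂ

/-- The kernel `E_q(z w̄)` on `|z| < 1 / √(1 - q)`. -/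
def qKernel (q : ℝ) : Matrix (Disk (qRadius q)) (Disk (qRadius q)) (ℂ →L[ℂ] ℂ) :=
  scalarKernel fun z w ↦ qExp q ((z : ℂ) * conj (w : ℂ))

/-- The Szegő kernel `1 / (1 - z w̄)` on the open unit disk. -/
def szegoKernel : Matrix (Disk 1) (Disk 1) (ℂ →L[ℂ] ℂ) :=
  scalarKernel fun z w ↦ 1 / (1 - (z : ℂ) * conj (w : ℂ))

theorem qFactorial_pos {q : ℝ} (hq : 0 ≤ q) (k : ℕ) : 0 < qFactorial q k := by
  refine Finset.prod_pos fun j _ ↦ ?_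
  rw [Finset.sum_range_succ']
  have : 0 ≤ ∑ i ∈ Finset.range j, q ^ (i + 1) := Finset.sum_nonneg fun i _ ↦ by positivity
  simp only [pow_zero]
  linarith

theorem summable_qExp {q : ℝ} (hq0 : 0 ≤ q) (hq1 : q < 1) {ζ : ℂ} (hζ : ‖ζ‖ < 1 / (1 - q)) :
    Summable fun k : ℕ ↦ ζ ^ k / (qFactorial q k : ℂ) := by
  rcases eq_or_ne ζ 0 with rfl | h0
  · refine summable_of_ne_finset_zero (s := {0}) fun k hk ↦ ?_
    have : k ≠ 0 := by simpa using hk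
    simp [this]
  have hpos := fun k ↦ qFactorial_pos hq0 k
  refine summable_of_ratio_test_tendsto_lt_one (l := ‖ζ‖ * (1 - q)) ?_ ?_ ?_
  · rwa [lt_div_iff₀ (by linarith)] at hζ
  · refine Eventually.of_forall fun k ↦ ?_
    have := (hpos k).ne'
    simp [h0, this]
  · have hlim : Tendsto (fun k : ℕ ↦ ‖ζ‖ * (∑ i ∈ Finset.range (k + 1), q ^ i)⁻¹) atTop
        (𝓝 (‖ζ‖ * (1 - q))) := by
      have h1 := (hasSum_geometric_of_lt_one hq0 hq1).tendsto_sum_nat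
      have h2 := (h1.comp (tendsto_add_atTop_nat 1)).inv₀
        (inv_ne_zero (by linarith : (1 - q) ≠ 0))
      rw [inv_inv] at h2
      exact h2.const_mul _
    refine hlim.congr fun k ↦ ?_
    have hk := hpos k
    have hk1 := hpos (k + 1)
    have hs : qFactorial q (k + 1) = qFactorial q k * ∑ i ∈ Finset.range (k + 1), q ^ i := by
      simp [qFactorial, Finset.prod_range_succ]
    have hsum : (∑ i ∈ Finset.range (k + 1), q ^ i) ≠ 0 := by
      intro h
      rw [hs, h, mul_zero] at hk1
      exact lt_irrefl _ hk1
    have hn : ‖ζ‖ ≠ 0 := by simpa using h0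
    rw [norm_div, norm_div, norm_pow, norm_pow, Complex.norm_real, Complex.norm_real,
      Real.norm_of_nonneg hk.le, Real.norm_of_nonneg hk1.le, hs]
    have hk' := hk.ne'
    field_simp
    ring

open scoped ComplexOrder in
/-- A kernel given by a power series in `z w̄` with nonnegative coefficients is positive. -/
theorem posSemidef_scalarKernel {R : ℝ} {k : Disk R → Disk R → ℂ} {c : ℕ → ℝ}
    (hc : ∀ n, 0 ≤ c n)
    (hk : ∀ z w : Disk R, HasSum (fun n ↦ (c n : ℂ) * ((z : ℂ) * conj (w : ℂ)) ^ n) (k z w)) :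
    (scalarKernel k).PosSemidef := by
  have htfae := (RKHS.posSemidef_tfae (K := scalarKernel k)).out 0 2
  refine htfae.mpr ⟨?_, fun v ↦ ?_⟩
  · ext z w
    have h1 := (hk w z).map (starRingEnd ℂ) Complex.continuous_conj
    have h2 : k z w = conj (k w z) := by
      refine (hk z w).unique (h1.congr_fun ?_)
      intro n
      simp [mul_comm]
    have h3 : star (ContinuousLinearMap.id ℂ ℂ) = ContinuousLinearMap.id ℂ ℂ :=
      star_one (ℂ →L[ℂ] ℂ)
    simp [scalarKernel, Matrix.conjTranspose_apply, h2, h3]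
  · have key : HasSum (fun n ↦ ((c n * ‖v.sum fun x a ↦ a * conj (x : ℂ) ^ n‖ ^ 2 : ℝ) : ℂ))
        (v.sum fun x w ↦ v.sum fun x' w' ↦ inner ℂ (scalarKernel k x' x w) w') := by
      have : HasSum (fun n ↦ ∑ x ∈ v.support, ∑ x' ∈ v.support,
          conj ((c n : ℂ) * ((x' : ℂ) * conj (x : ℂ)) ^ n) * (conj (v x) * v x'))
          (∑ x ∈ v.support, ∑ x' ∈ v.support, conj (k x' x) * (conj (v x) * v x')) := by
        refine hasSum_sum fun x _ ↦ hasSum_sum fun x' _ ↦ ?_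
        exact ((hk x' x).map (starRingEnd ℂ) Complex.continuous_conj).mul_right _
      convert this using 1
      · funext n
        rw [Complex.ofReal_mul, Complex.ofReal_pow, ← Complex.conj_mul', Finsupp.sum, map_sum,
          Finset.sum_mul_sum, Finset.mul_sum]
        refine Finset.sum_congr rfl fun x _ ↦ ?_
        rw [Finset.mul_sum]
        refine Finset.sum_congr rfl fun x' _ ↦ ?_
        simp [mul_pow]
        ring
      · simp only [Finsupp.sum]
        refine Finset.sum_congr rfl fun x _ ↦ Finset.sum_congr rfl fun x' _ ↦ ?_
        simp [scalarKernel]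
        ring
    have h2 := Complex.hasSum_re key
    exact h2.nonneg fun n ↦ by
      rw [Complex.ofReal_re]
      exact mul_nonneg (hc n) (by positivity)

theorem norm_mul_conj_lt {R : ℝ} (z w : Disk R) : ‖(z : ℂ) * conj (w : ℂ)‖ < R ^ 2 := by
  have hz : ‖(z : ℂ)‖ < R := mem_ball_zero_iff.1 z.2
  have hw : ‖(w : ℂ)‖ < R := mem_ball_zero_iff.1 w.2
  rw [norm_mul, RCLike.norm_conj, sq]
  exact mul_lt_mul'' hz hw (norm_nonneg _) (norm_nonneg _)

open scoped ComplexOrder in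
instance (q : Set.Ico (0 : ℝ) 1) : Fact (qKernel (q : ℝ)).PosSemidef := by
  obtain ⟨q, hq0, hq1⟩ := q
  refine ⟨posSemidef_scalarKernel (c := fun n ↦ (qFactorial q n)⁻¹)
    (fun n ↦ (inv_pos.2 (qFactorial_pos hq0 n)).le) fun z w ↦ ?_⟩
  have hR : qRadius q ^ 2 = 1 / (1 - q) := by
    rw [qRadius, div_pow, one_pow, Real.sq_sqrt (by linarith)]
  have h := (norm_mul_conj_lt z w).trans_eq hR
  refine (summable_qExp hq0 hq1 h).hasSum.congr_fun fun n ↦ ?_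
  rw [Complex.ofReal_inv, div_eq_mul_inv, mul_comm]

open scoped ComplexOrder in
instance : Fact szegoKernel.PosSemidef := by
  refine ⟨posSemidef_scalarKernel (c := fun _ ↦ 1) (fun _ ↦ zero_le_one) fun z w ↦ ?_⟩
  have h := norm_mul_conj_lt z w
  rw [one_pow] at h
  simpa using hasSum_geometric_of_norm_lt_one h

/-- `H_{2,q}`, the reproducing kernel Hilbert space with kernel `E_q(z w̄)`, for `0 ≤ q < 1`. -/
abbrev H2q (q : Set.Ico (0 : ℝ) 1) : Type := RKHS.OfKernel (qKernel (q : ℝ))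

/-- The Hardy space of the unit disk, the reproducing kernel Hilbert space with the Szegő kernel. -/
abbrev HardyH2 : Type := RKHS.OfKernel szegoKernel

/-- Multiplication by `s` is a contractive operator from the reproducing kernel Hilbert space `H`
of functions on the disk of radius `R` into itself. -/
def IsContractiveMulOp {R : ℝ} (H : Type) [NormedAddCommGroup H] [InnerProductSpace ℂ H]
    [RKHS ℂ H (Disk R) ℂ] (s : ℂ → ℂ) : Prop :=
  ∃ M : H →L[ℂ] H, (∀ (f : H) (z : Disk R), M f z = s z * f z) ∧ ‖M‖ ≤ 1

/-- A Schur multiplier of `H`: an analytic function on the disk of radius `R` such that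
multiplication by it is a contraction of `H`. -/
def IsSchurMultiplier {R : ℝ} (H : Type) [NormedAddCommGroup H] [InnerProductSpace ℂ H]
    [RKHS ℂ H (Disk R) ℂ] (s : ℂ → ℂ) : Prop :=
  AnalyticOnNhd ℂ s (Metric.ball 0 R) ∧ IsContractiveMulOp H s

/-- A Schur function: analytic and bounded by one in modulus in the open unit disk. -/
def IsSchurFunction (σ : ℂ → ℂ) : Prop :=
  AnalyticOnNhd ℂ σ (Metric.ball 0 1) ∧ ∀ z ∈ Metric.ball (0 : ℂ) 1, ‖σ z‖ ≤ 1

end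

/-!
Multiplication by `s` is a contraction of the reproducing kernel Hilbert space with kernel `k` iff
the kernel `(1 - s(z) s(w)*) k(z, w)` is positive, because the adjoint of multiplication by `s`
sends the kernel function at `w` to `s(w)*` times itself. Its diagonal then gives `|s| ≤ 1`.

Conversely, comparing coefficients gives the `q`-difference equation
`E_q(ζ) (1 - (1 - q) ζ) = E_q(q ζ)`, so that `E_q(z w̄)` is the product of the positive kernel
`E_q(q z w̄)` and the Szegő kernel `1 / (1 - (1 - q) z w̄)` of the disk of radius `1 / √(1 - q)`.
By the Schur product theorem positivity reduces to that of the Pick kernel of a Schur function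
`σ`. For `σ` continuous up to the circle, the Pick kernel is an average over the circle of positive
matrices, by Cauchy's formula; the general case follows by dilation.
-/

open ComplexConjugate Filter Topology
open scoped ComplexOrder Matrix

section PosSemidef

variable {𝕜 n E F : Type*} [RCLike 𝕜] [NormedAddCommGroup E] [InnerProductSpace 𝕜 E]
  [NormedAddCommGroup F] [InnerProductSpace 𝕜 F]

theorem sum_star_mul_gram_mul (v : n → E) (c : n →₀ 𝕜) :
    (c.sum fun i ci ↦ c.sum fun j cj ↦ star ci * Matrix.gram 𝕜 v i j * cj) =
      (‖Finsupp.linearCombination 𝕜 v c‖ ^ 2 : ℝ) := by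
  rw [RCLike.ofReal_pow, ← inner_self_eq_norm_sq_to_K, Finsupp.linearCombination_apply,
    Finsupp.sum_inner]
  refine Finsupp.sum_congr fun i _ ↦ ?_
  rw [Finsupp.inner_sum]
  refine Finsupp.sum_congr fun j _ ↦ ?_
  rw [Matrix.gram_apply, inner_smul_left, inner_smul_right, RCLike.star_def]
  ring

theorem posSemidef_gram_sub_gram_iff {v : n → E} {w : n → F} :
    (Matrix.gram 𝕜 v - Matrix.gram 𝕜 w).PosSemidef ↔
      ∀ c : n →₀ 𝕜, ‖Finsupp.linearCombination 𝕜 w c‖ ≤ ‖Finsupp.linearCombination 𝕜 v c‖ := by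
  have key (c : n →₀ 𝕜) : (c.sum fun i ci ↦ c.sum fun j cj ↦
      star ci * (Matrix.gram 𝕜 v - Matrix.gram 𝕜 w) i j * cj) =
      ((‖Finsupp.linearCombination 𝕜 v c‖ ^ 2 -
        ‖Finsupp.linearCombination 𝕜 w c‖ ^ 2 : ℝ) : 𝕜) := by
    rw [RCLike.ofReal_sub, ← sum_star_mul_gram_mul, ← sum_star_mul_gram_mul]
    simp only [Matrix.sub_apply, mul_sub, sub_mul, Finsupp.sum_sub]
  refine (and_iff_right ((Matrix.isHermitian_gram 𝕜 v).sub (Matrix.isHermitian_gram 𝕜 w))).trans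
    (forall_congr' fun c ↦ ?_)
  rw [key, RCLike.ofReal_nonneg, sub_nonneg, sq_le_sq₀ (norm_nonneg _) (norm_nonneg _)]

theorem exists_contraction_apply_eq_iff [CompleteSpace F] {v : n → E} {w : n → F}
    (hv : Dense (Submodule.span 𝕜 (Set.range v) : Set E)) :
    (∃ T : E →L[𝕜] F, (∀ i, T (v i) = w i) ∧ ‖T‖ ≤ 1) ↔
      (Matrix.gram 𝕜 v - Matrix.gram 𝕜 w).PosSemidef := by
  rw [posSemidef_gram_sub_gram_iff]
  constructor
  · rintro ⟨T, hT, hT1⟩ c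
    have hTc : T (Finsupp.linearCombination 𝕜 v c) = Finsupp.linearCombination 𝕜 w c := by
      simp [Finsupp.linearCombination_apply, map_finsuppSum, hT]
    simpa [hTc] using T.le_of_opNorm_le hT1 (Finsupp.linearCombination 𝕜 v c)
  · intro h
    have hdense : DenseRange (Finsupp.linearCombination 𝕜 v) := by
      rwa [DenseRange, ← LinearMap.coe_range, Finsupp.range_linearCombination]
    have hle (c : n →₀ 𝕜) : ‖Finsupp.linearCombination 𝕜 w c‖ ≤
        1 * ‖Finsupp.linearCombination 𝕜 v c‖ := by simpa using h c
    refine ⟨(Finsupp.linearCombination 𝕜 w).extendOfNorm (Finsupp.linearCombination 𝕜 v),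
      fun i ↦ ?_, LinearMap.opNorm_extendOfNorm_le hdense zero_le_one hle⟩
    simpa using LinearMap.extendOfNorm_eq hdense ⟨1, hle⟩ (Finsupp.single i 1)

theorem posSemidef_gram (v : n → E) : (Matrix.gram 𝕜 v).PosSemidef :=
  ⟨Matrix.isHermitian_gram 𝕜 v, fun c ↦ by
    rw [sum_star_mul_gram_mul, RCLike.ofReal_nonneg]
    positivity⟩

theorem posSemidef_of_tendsto {α : Type*} {l : Filter α} [l.NeBot] {M : α → Matrix n n 𝕜}
    {A : Matrix n n 𝕜} (hM : ∀ᶠ a in l, (M a).PosSemidef)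
    (hA : ∀ i j, Tendsto (fun a ↦ M a i j) l (𝓝 (A i j))) : A.PosSemidef := by
  refine ⟨Matrix.ext fun i j ↦ tendsto_nhds_unique_of_eventuallyEq (hA j i).star (hA i j)
    (hM.mono fun a ha ↦ ha.isHermitian.apply i j), fun c ↦ ge_of_tendsto
    (f := fun a ↦ c.sum fun i ci ↦ c.sum fun j cj ↦ star ci * M a i j * cj) ?_
    (hM.mono fun a ha ↦ ha.2 c)⟩
  exact tendsto_finsetSum _ fun i _ ↦ tendsto_finsetSum _ fun j _ ↦
    ((hA i j).const_mul _).mul_const _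

theorem circleAverage_nonneg {f : ℂ → ℂ} {c : ℂ} {R : ℝ} (hf : ∀ z ∈ Metric.sphere c |R|, 0 ≤ f z) :
    0 ≤ Real.circleAverage f c R := by
  rw [Real.circleAverage_def, intervalIntegral.integral_of_le (by positivity)]
  exact smul_nonneg (by positivity)
    (MeasureTheory.integral_nonneg fun θ ↦ hf _ (circleMap_mem_sphere' c R θ))

theorem circleAverage_conj {f : ℂ → ℂ} {c : ℂ} {R : ℝ} (hf : CircleIntegrable f c R) :
    Real.circleAverage (fun z ↦ conj (f z)) c R = conj (Real.circleAverage f c R) :=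
  Complex.conjCLE.toContinuousLinearMap.circleAverage_comp_comm hf

theorem posSemidef_circleAverage {M : ℂ → Matrix n n ℂ} {c : ℂ} {R : ℝ}
    (hM : ∀ z ∈ Metric.sphere c |R|, (M z).PosSemidef)
    (hint : ∀ i j, CircleIntegrable (fun z ↦ M z i j) c R) :
    (Matrix.of fun i j ↦ Real.circleAverage (fun z ↦ M z i j) c R).PosSemidef := by
  refine ⟨Matrix.ext fun i j ↦ ?_, fun v ↦ ?_⟩
  · calc conj (Real.circleAverage (fun z ↦ M z j i) c R)
        = Real.circleAverage (fun z ↦ conj (M z j i)) c R :=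
          (circleAverage_conj (hint j i)).symm
      _ = Real.circleAverage (fun z ↦ M z i j) c R :=
          Real.circleAverage_congr_sphere fun z hz ↦ (hM z hz).isHermitian.apply i j
  · suffices (v.sum fun i vi ↦ v.sum fun j vj ↦
        star vi * Real.circleAverage (fun z ↦ M z i j) c R * vj) =
        Real.circleAverage
          (fun z ↦ v.sum fun i vi ↦ v.sum fun j vj ↦ star vi * M z i j * vj) c R from
      this.trans_ge (circleAverage_nonneg fun z hz ↦ (hM z hz).2 v)
    have hterm i j : CircleIntegrable (fun z ↦ star (v i) * M z i j * v j) c R := by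
      simpa only [smul_eq_mul, mul_right_comm] using
        ((hint i j).const_fun_smul (a := star (v i) * v j))
    simp only [Finsupp.sum]
    rw [Real.circleAverage_fun_sum fun i _ ↦ CircleIntegrable.fun_sum _ fun j _ ↦ hterm i j]
    refine Finset.sum_congr rfl fun i _ ↦ ?_
    rw [Real.circleAverage_fun_sum fun j _ ↦ hterm i j]
    refine Finset.sum_congr rfl fun j _ ↦ ?_
    rw [mul_right_comm, ← smul_eq_mul, ← Real.circleAverage_fun_smul]
    simp only [smul_eq_mul, mul_right_comm]

end PosSemidef

section Multipliers

variable {𝕜 X H : Type*} [RCLike 𝕜] [NormedAddCommGroup H] [InnerProductSpace 𝕜 H]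
  [RKHS 𝕜 H X 𝕜]

/-- The kernel `(1 - s(x) s(y)*) k(x, y)`, whose positivity characterizes the contractive
multipliers `s` of the reproducing kernel Hilbert space with kernel `k`. -/
def multiplierKernel {X : Type*} (k : X → X → 𝕜) (s : X → 𝕜) : Matrix X X 𝕜 :=
  .of fun x y ↦ (1 - s x * conj (s y)) * k x y

variable [CompleteSpace H] {k : X → X → 𝕜}

theorem gram_kerFun_one (hk : ∀ x y, RKHS.kernel H x y 1 = k x y) :
    Matrix.gram 𝕜 (fun x : X ↦ RKHS.kerFun H x (1 : 𝕜)) = .of k := by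
  ext x y
  rw [Matrix.gram_apply, RKHS.kerFun_inner, RKHS.kerFun_apply, hk, Matrix.of_apply,
    RCLike.inner_apply, map_one, mul_one]

theorem multiplierKernel_eq_gram_sub_gram (hk : ∀ x y, RKHS.kernel H x y 1 = k x y) (s : X → 𝕜) :
    multiplierKernel k s = Matrix.gram 𝕜 (fun x : X ↦ RKHS.kerFun H x (1 : 𝕜)) -
      Matrix.gram 𝕜 (fun x : X ↦ conj (s x) • RKHS.kerFun H x (1 : 𝕜)) := by
  ext x y
  have hxy := congrFun₂ (gram_kerFun_one hk) x y
  simp only [Matrix.gram_apply, Matrix.of_apply] at hxy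
  simp only [multiplierKernel, Matrix.of_apply, Matrix.sub_apply, Matrix.gram_apply,
    inner_smul_left, inner_smul_right, hxy, RCLike.conj_conj]
  ring

theorem forall_apply_eq_mul_iff_adjoint_kerFun {M : H →L[𝕜] H} {s : X → 𝕜} :
    (∀ (f : H) (x : X), M f x = s x * f x) ↔
      ∀ x : X, M.adjoint (RKHS.kerFun H x (1 : 𝕜)) = conj (s x) • RKHS.kerFun H x (1 : 𝕜) := by
  rw [forall_comm]
  refine forall_congr' fun x ↦ (forall_congr' fun f ↦ ?_).trans (ext_iff_inner_right 𝕜).symm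
  rw [ContinuousLinearMap.adjoint_inner_left, inner_smul_left, RKHS.kerFun_inner,
    RKHS.kerFun_inner]
  simp

variable (H) in
theorem dense_span_range_kerFun_one :
    Dense (Submodule.span 𝕜 (Set.range fun x : X ↦ RKHS.kerFun H x (1 : 𝕜)) : Set H) := by
  refine (Submodule.dense_iff_topologicalClosure_eq_top.2 (RKHS.kerFun_dense H)).mono ?_
  rw [SetLike.coe_subset_coe, Submodule.span_le]
  rintro _ ⟨x, v, rfl⟩
  rw [← mul_one v, ← smul_eq_mul, map_smul]
  exact Submodule.smul_mem _ _ (Submodule.subset_span ⟨x, rfl⟩)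

theorem exists_contraction_mul_iff_posSemidef (hk : ∀ x y, RKHS.kernel H x y 1 = k x y)
    {s : X → 𝕜} :
    (∃ M : H →L[𝕜] H, (∀ (f : H) (x : X), M f x = s x * f x) ∧ ‖M‖ ≤ 1) ↔
      (multiplierKernel k s).PosSemidef := by
  rw [multiplierKernel_eq_gram_sub_gram hk,
    ← exists_contraction_apply_eq_iff (dense_span_range_kerFun_one H),
    (ContinuousLinearMap.adjoint (𝕜 := 𝕜) (E := H) (F := H)).surjective.exists]
  simp only [forall_apply_eq_mul_iff_adjoint_kerFun, ContinuousLinearMap.adjoint_adjoint,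
    LinearIsometryEquiv.norm_map]

end Multipliers

noncomputable section Pick

/-- The Szegő kernel function `k_w : z ↦ 1 / (1 - z w̄)` at the point `w`. -/
def szegoFun (w z : ℂ) : ℂ := 1 / (1 - z * conj w)

theorem diffContOnCl_szegoFun {w : ℂ} (hw : w ∈ Metric.ball 0 1) :
    DiffContOnCl ℂ (szegoFun w) (Metric.ball 0 1) := by
  refine DifferentiableOn.diffContOnCl fun z hz ↦ ?_
  rw [closure_ball _ one_ne_zero, mem_closedBall_zero_iff] at hz
  rw [mem_ball_zero_iff] at hw
  have hzw : ‖z * conj w‖ < 1 := by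
    rw [norm_mul, RCLike.norm_conj]
    exact mul_lt_one_of_nonneg_of_lt_one_right hz (norm_nonneg w) hw
  have hne : 1 - z * conj w ≠ 0 := sub_ne_zero.2 fun h ↦ hzw.ne (h ▸ norm_one)
  unfold szegoFun
  exact DifferentiableAt.differentiableWithinAt (by fun_prop (disch := exact hne))

theorem circleIntegrable_conj_mul {f g : ℂ → ℂ} (hf : DiffContOnCl ℂ f (Metric.ball 0 1))
    (hg : DiffContOnCl ℂ g (Metric.ball 0 1)) :
    CircleIntegrable (fun z ↦ conj (f z) * g z) 0 1 := by
  have hs : Metric.sphere (0 : ℂ) 1 ⊆ closure (Metric.ball 0 1) := by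
    rw [closure_ball _ one_ne_zero]
    exact Metric.sphere_subset_closedBall
  exact ContinuousOn.circleIntegrable zero_le_one
    ((Complex.continuous_conj.comp_continuousOn (hf.continuousOn.mono hs)).mul
      (hg.continuousOn.mono hs))

theorem circleAverage_conj_szegoFun_mul {f : ℂ → ℂ} (hf : DiffContOnCl ℂ f (Metric.ball 0 1))
    {w : ℂ} (hw : w ∈ Metric.ball 0 1) :
    Real.circleAverage (fun z ↦ conj (szegoFun w z) * f z) 0 1 = f w := by
  rw [← DiffContOnCl.circleAverage_smul_div (R := 1) (c := 0) (f := f) (w := w)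
    (by simpa using hf) (by simpa using hw)]
  refine Real.circleAverage_congr_sphere fun z hz ↦ ?_
  have hz1 : ‖z‖ = 1 := by simpa using hz
  have hz0 : z ≠ 0 := norm_ne_zero_iff.1 (hz1 ▸ one_ne_zero)
  have hconj : 1 - conj z * w = (z - w) / z := by
    rw [← Complex.inv_eq_conj hz1]
    field_simp
  simp [szegoFun, hconj]

theorem circleAverage_conj_mul_szegoFun {f : ℂ → ℂ} (hf : DiffContOnCl ℂ f (Metric.ball 0 1))
    {w : ℂ} (hw : w ∈ Metric.ball 0 1) :
    Real.circleAverage (fun z ↦ conj (f z) * szegoFun w z) 0 1 = conj (f w) := by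
  rw [← circleAverage_conj_szegoFun_mul hf hw,
    ← circleAverage_conj (circleIntegrable_conj_mul (diffContOnCl_szegoFun hw) hf)]
  simp only [map_mul, Complex.conj_conj, mul_comm]

/-- The kernel `(1 - σ(z) σ(w)*) / (1 - z w̄)` of Pick's theorem on the unit disk. -/
def pickKernel (σ : ℂ → ℂ) : Matrix (Disk 1) (Disk 1) ℂ :=
  multiplierKernel (fun z w ↦ szegoFun w z) fun z ↦ σ z

/-- The positive matrix whose average over `ζ` in the unit circle is the Pick kernel of `σ`: with
`u_z = k_z - σ · σ(z)* k_z`, its entries are `u_z* u_w + (1 - |σ|²) (σ(z)* k_z)* (σ(w)* k_w)`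
at `ζ`. -/
def pickDensity (σ : ℂ → ℂ) (ζ : ℂ) : Matrix (Disk 1) (Disk 1) ℂ :=
  Matrix.gram ℂ (fun z : Disk 1 ↦ (1 - σ ζ * conj (σ z)) * szegoFun z ζ) +
    (1 - ‖σ ζ‖ ^ 2) • Matrix.gram ℂ fun z : Disk 1 ↦ conj (σ z) * szegoFun z ζ

theorem posSemidef_pickDensity {σ : ℂ → ℂ} {ζ : ℂ} (hσ : ‖σ ζ‖ ≤ 1) :
    (pickDensity σ ζ).PosSemidef :=
  (posSemidef_gram _).add ((posSemidef_gram _).smul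
    (sub_nonneg.2 (pow_le_one₀ (norm_nonneg _) hσ)))

theorem pickDensity_apply (σ : ℂ → ℂ) (ζ : ℂ) (z w : Disk 1) :
    pickDensity σ ζ z w =
      conj (szegoFun z ζ) * ((1 - σ ζ * conj (σ w)) * szegoFun w ζ) +
        σ z * (conj ((σ w - σ ζ) * szegoFun z ζ) * szegoFun w ζ) := by
  have hσ : ((‖σ ζ‖ : ℂ)) ^ 2 = conj (σ ζ) * σ ζ := (Complex.conj_mul' _).symm
  simp only [pickDensity, Matrix.add_apply, Matrix.smul_apply, Matrix.gram_apply,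
    RCLike.inner_apply, Complex.real_smul, map_mul, map_sub, map_one, Complex.conj_conj,
    Complex.ofReal_sub, Complex.ofReal_one, Complex.ofReal_pow, hσ]
  ring

theorem diffContOnCl_one_sub_mul_szegoFun {σ : ℂ → ℂ} (hσ : DiffContOnCl ℂ σ (Metric.ball 0 1))
    (a : ℂ) {w : ℂ} (hw : w ∈ Metric.ball 0 1) :
    DiffContOnCl ℂ (fun ζ ↦ (1 - σ ζ * a) * szegoFun w ζ) (Metric.ball 0 1) :=
  ((hσ.smul_const a).const_sub 1).smul (diffContOnCl_szegoFun hw)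

theorem diffContOnCl_sub_mul_szegoFun {σ : ℂ → ℂ} (hσ : DiffContOnCl ℂ σ (Metric.ball 0 1))
    (a : ℂ) {w : ℂ} (hw : w ∈ Metric.ball 0 1) :
    DiffContOnCl ℂ (fun ζ ↦ (a - σ ζ) * szegoFun w ζ) (Metric.ball 0 1) :=
  (hσ.const_sub a).smul (diffContOnCl_szegoFun hw)

theorem circleIntegrable_pickDensity {σ : ℂ → ℂ} (hσ : DiffContOnCl ℂ σ (Metric.ball 0 1))
    (z w : Disk 1) : CircleIntegrable (fun ζ ↦ pickDensity σ ζ z w) 0 1 := by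
  simp only [pickDensity_apply]
  exact (circleIntegrable_conj_mul (diffContOnCl_szegoFun z.2)
    (diffContOnCl_one_sub_mul_szegoFun hσ _ w.2)).add
    (circleIntegrable_conj_mul (diffContOnCl_sub_mul_szegoFun hσ _ z.2)
      (diffContOnCl_szegoFun w.2)).const_fun_smul

theorem circleAverage_pickDensity {σ : ℂ → ℂ} (hσ : DiffContOnCl ℂ σ (Metric.ball 0 1))
    (z w : Disk 1) : Real.circleAverage (fun ζ ↦ pickDensity σ ζ z w) 0 1 = pickKernel σ z w := by
  have hA := diffContOnCl_one_sub_mul_szegoFun hσ (conj (σ w)) w.2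
  have hB := diffContOnCl_sub_mul_szegoFun hσ (σ w) z.2
  simp only [pickDensity_apply, ← smul_eq_mul (σ z)]
  rw [Real.circleAverage_fun_add (circleIntegrable_conj_mul (diffContOnCl_szegoFun z.2) hA)
    (circleIntegrable_conj_mul hB (diffContOnCl_szegoFun w.2)).const_fun_smul,
    Real.circleAverage_fun_smul, circleAverage_conj_szegoFun_mul hA z.2,
    circleAverage_conj_mul_szegoFun hB w.2]
  simp [pickKernel, multiplierKernel]

theorem posSemidef_pickKernel {σ : ℂ → ℂ} (hσ : DiffContOnCl ℂ σ (Metric.ball 0 1))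
    (hσ1 : ∀ z ∈ Metric.sphere (0 : ℂ) 1, ‖σ z‖ ≤ 1) : (pickKernel σ).PosSemidef := by
  have havg : pickKernel σ =
      .of fun z w ↦ Real.circleAverage (fun ζ ↦ pickDensity σ ζ z w) 0 1 :=
    Matrix.ext fun z w ↦ (circleAverage_pickDensity hσ z w).symm
  rw [havg]
  exact posSemidef_circleAverage
    (fun ζ hζ ↦ posSemidef_pickDensity (hσ1 ζ (by rwa [abs_one] at hζ)))
    (circleIntegrable_pickDensity hσ)

theorem IsSchurFunction.posSemidef_pickKernel_dilation {σ : ℂ → ℂ} (hσ : IsSchurFunction σ) {r : ℝ}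
    (hr : r ∈ Set.Ioo (0 : ℝ) 1) : (pickKernel fun z ↦ σ (r * z)).PosSemidef := by
  have hmem {z : ℂ} (hz : ‖z‖ ≤ 1) : (r : ℂ) * z ∈ Metric.ball (0 : ℂ) 1 := by
    rw [mem_ball_zero_iff, norm_mul, Complex.norm_real, Real.norm_of_nonneg hr.1.le]
    exact mul_lt_one_of_nonneg_of_lt_one_left hr.1.le hr.2 hz
  refine posSemidef_pickKernel (DifferentiableOn.diffContOnCl fun z hz ↦ ?_) fun z hz ↦
    hσ.2 _ (hmem (mem_sphere_zero_iff_norm.1 hz).le)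
  rw [closure_ball _ one_ne_zero, mem_closedBall_zero_iff] at hz
  exact ((hσ.1 _ (hmem hz)).differentiableAt.comp z (by fun_prop)).differentiableWithinAt

theorem IsSchurFunction.posSemidef_pickKernel {σ : ℂ → ℂ} (hσ : IsSchurFunction σ) :
    (pickKernel σ).PosSemidef := by
  have hlim (z : Disk 1) : Tendsto (fun r : ℝ ↦ σ (r * z)) (𝓝[<] 1) (𝓝 (σ z)) := by
    have hcont : ContinuousAt (fun r : ℝ ↦ σ (r * z)) 1 :=
      ContinuousAt.comp (g := σ) (f := fun r : ℝ ↦ (r : ℂ) * z)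
        (by simpa using (hσ.1 _ z.2).continuousAt) (by fun_prop)
    simpa using hcont.tendsto.mono_left nhdsWithin_le_nhds
  refine posSemidef_of_tendsto (l := 𝓝[<] (1 : ℝ)) (M := fun r ↦ pickKernel fun z ↦ σ (r * z))
    ?_ fun z w ↦ ?_
  · filter_upwards [Ioo_mem_nhdsLT zero_lt_one] with r hr
    exact hσ.posSemidef_pickKernel_dilation hr
  · exact (((hlim z).mul (hlim w).star).const_sub 1).mul_const _

end Pick

section Disk

theorem norm_le_one_of_posSemidef_multiplierKernel {𝕜 X : Type*} [RCLike 𝕜] {k : X → X → 𝕜}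
    {s : X → 𝕜} (h : (multiplierKernel k s).PosSemidef) {x : X} (hx : 0 < k x x) : ‖s x‖ ≤ 1 := by
  have hdiag : 0 ≤ (1 - s x * conj (s x)) * k x x := h.diag_nonneg
  have hs : (0 : 𝕜) ≤ ((1 - ‖s x‖ ^ 2 : ℝ) : 𝕜) := by
    rw [RCLike.mul_conj, ← zero_mul (k x x)] at hdiag
    simpa using le_of_mul_le_mul_right hdiag hx
  rw [RCLike.ofReal_nonneg, sub_nonneg] at hs
  exact (sq_le_one_iff₀ (norm_nonneg _)).1 hs

theorem IsSchurFunction.posSemidef_multiplierKernel {σ : ℂ → ℂ} (hσ : IsSchurFunction σ)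
    {X : Type*} (φ : X → Disk 1) {D : Matrix X X ℂ} (hD : D.PosSemidef) :
    (multiplierKernel (fun x y ↦ D x y * szegoFun (φ y) (φ x)) fun x ↦ σ (φ x)).PosSemidef := by
  convert! hD.hadamard (hσ.posSemidef_pickKernel.submatrix φ) using 1
  ext x y
  simp only [multiplierKernel, pickKernel, Matrix.of_apply, Matrix.hadamard_apply,
    Matrix.submatrix_apply]
  ring

theorem IsSchurFunction.congr {σ τ : ℂ → ℂ} (hσ : IsSchurFunction σ)
    (h : Set.EqOn σ τ (Metric.ball 0 1)) : IsSchurFunction τ :=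
  ⟨hσ.1.congr Metric.isOpen_ball h, fun z hz ↦ h hz ▸ hσ.2 z hz⟩

theorem ofReal_mul_mem_ball_iff {R : ℝ} (hR : 0 < R) {z : ℂ} :
    (R : ℂ) * z ∈ Metric.ball 0 R ↔ z ∈ Metric.ball 0 1 := by
  rw [mem_ball_zero_iff, mem_ball_zero_iff, norm_mul, Complex.norm_real,
    Real.norm_of_nonneg hR.le, mul_lt_iff_lt_one_right hR]

theorem div_ofReal_mem_ball_iff {R : ℝ} (hR : 0 < R) {z : ℂ} :
    z / R ∈ Metric.ball 0 1 ↔ z ∈ Metric.ball 0 R := by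
  rw [← ofReal_mul_mem_ball_iff hR, mul_div_cancel₀ z (Complex.ofReal_ne_zero.2 hR.ne')]

theorem analyticOnNhd_comp_ofReal_mul_iff {R : ℝ} (hR : 0 < R) {s : ℂ → ℂ} :
    AnalyticOnNhd ℂ (fun z ↦ s (R * z)) (Metric.ball 0 1) ↔
      AnalyticOnNhd ℂ s (Metric.ball 0 R) := by
  have hR' : (R : ℂ) ≠ 0 := Complex.ofReal_ne_zero.2 hR.ne'
  constructor
  · intro h
    have hcomp : AnalyticOnNhd ℂ (fun z ↦ s (R * (z / R))) (Metric.ball 0 R) := fun z hz ↦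
      (h _ ((div_ofReal_mem_ball_iff hR).2 hz)).comp_of_eq (f := fun z : ℂ ↦ z / (R : ℂ))
        (by fun_prop (disch := exact hR')) rfl
    simpa only [mul_div_cancel₀ _ hR'] using hcomp
  · exact fun h z hz ↦ (h _ ((ofReal_mul_mem_ball_iff hR).2 hz)).comp_of_eq (by fun_prop) rfl

variable {R : ℝ} {H : Type} [NormedAddCommGroup H] [InnerProductSpace ℂ H]
  [RKHS ℂ H (Disk R) ℂ] [CompleteSpace H] {D : Matrix (Disk R) (Disk R) ℂ} {s : ℂ → ℂ}

theorem isContractiveMulOp_iff_isSchurFunction (hR : 0 < R) (hD : D.PosSemidef)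
    (hk : ∀ z w : Disk R, RKHS.kernel H z w 1 = D z w * szegoFun (w / R) (z / R))
    (hpos : ∀ z : Disk R, 0 < RKHS.kernel H z z 1) (hs : AnalyticOnNhd ℂ s (Metric.ball 0 R)) :
    IsContractiveMulOp H s ↔ IsSchurFunction fun z ↦ s (R * z) := by
  have hR' : (R : ℂ) ≠ 0 := Complex.ofReal_ne_zero.2 hR.ne'
  have hcriterion : IsContractiveMulOp H s ↔ _ :=
    exists_contraction_mul_iff_posSemidef (s := fun z : Disk R ↦ s z) hk
  rw [hcriterion]
  constructor
  · intro h
    refine ⟨(analyticOnNhd_comp_ofReal_mul_iff hR).2 hs, fun z hz ↦ ?_⟩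
    exact norm_le_one_of_posSemidef_multiplierKernel h
      (x := ⟨R * z, (ofReal_mul_mem_ball_iff hR).2 hz⟩) (hk _ _ ▸ hpos _)
  · intro hσ
    simpa only [mul_div_cancel₀ _ hR'] using
      hσ.posSemidef_multiplierKernel
        (fun z : Disk R ↦ ⟨z / R, (div_ofReal_mem_ball_iff hR).2 z.2⟩) hD

theorem isSchurMultiplier_iff_isSchurFunction (hR : 0 < R) (hD : D.PosSemidef)
    (hk : ∀ z w : Disk R, RKHS.kernel H z w 1 = D z w * szegoFun (w / R) (z / R))
    (hpos : ∀ z : Disk R, 0 < RKHS.kernel H z z 1) :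
    IsSchurMultiplier H s ↔ IsSchurFunction fun z ↦ s (R * z) :=
  ⟨fun h ↦ (isContractiveMulOp_iff_isSchurFunction hR hD hk hpos h.1).1 h.2, fun h ↦
    have hs := (analyticOnNhd_comp_ofReal_mul_iff hR).1 h.1
    ⟨hs, (isContractiveMulOp_iff_isSchurFunction hR hD hk hpos hs).2 h⟩⟩

end Disk

section ScalarKernel

theorem scalarKernel_apply_one {X : Type} (k : X → X → ℂ) (x y : X) :
    scalarKernel k x y 1 = k x y := by
  simp [scalarKernel]

theorem posSemidef_of_posSemidef_scalarKernel {X : Type} {k : X → X → ℂ}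
    (h : (scalarKernel k).PosSemidef) : (Matrix.of k).PosSemidef := by
  have := Fact.mk h
  rw [← gram_kerFun_one (H := RKHS.OfKernel (scalarKernel k)) fun x y ↦ by
    rw [RKHS.OfKernel.kernel_ofKernel, scalarKernel_apply_one]]
  exact posSemidef_gram _

end ScalarKernel

section QExp

variable {q : ℝ} {ζ : ℂ}

theorem hasSum_qExp (hq0 : 0 ≤ q) (hq1 : q < 1) (hζ : ‖ζ‖ < 1 / (1 - q)) :
    HasSum (fun n : ℕ ↦ ζ ^ n / (qFactorial q n : ℂ)) (qExp q ζ) :=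
  (summable_qExp hq0 hq1 hζ).hasSum

theorem norm_ofReal_mul_lt (hq0 : 0 ≤ q) (hq1 : q < 1) {r : ℝ} (hζ : ‖ζ‖ < r) :
    ‖(q : ℂ) * ζ‖ < r := by
  rw [norm_mul, Complex.norm_real, Real.norm_of_nonneg hq0]
  exact (mul_le_of_le_one_left (norm_nonneg ζ) hq1.le).trans_lt hζ

theorem one_sub_pow_succ_div_qFactorial_succ (hq0 : 0 ≤ q) (n : ℕ) :
    (1 - q ^ (n + 1)) / qFactorial q (n + 1) = (1 - q) / qFactorial q n := by
  have hsucc : qFactorial q (n + 1) = qFactorial q n * ∑ i ∈ Finset.range (n + 1), q ^ i :=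
    Finset.prod_range_succ _ n
  rw [div_eq_div_iff (qFactorial_pos hq0 _).ne' (qFactorial_pos hq0 _).ne', hsucc,
    ← mul_neg_geom_sum q (n + 1)]
  ring

theorem qExp_mul_one_sub (hq0 : 0 ≤ q) (hq1 : q < 1) (hζ : ‖ζ‖ < 1 / (1 - q)) :
    qExp q ζ * (1 - (1 - q) * ζ) = qExp q (q * ζ) := by
  have hdiff := (hasSum_qExp hq0 hq1 hζ).sub
    (hasSum_qExp hq0 hq1 (norm_ofReal_mul_lt hq0 hq1 hζ))
  have hshift (n : ℕ) : ζ ^ (n + 1) / (qFactorial q (n + 1) : ℂ) -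
      (q * ζ) ^ (n + 1) / (qFactorial q (n + 1) : ℂ) =
      (1 - q) * ζ * (ζ ^ n / (qFactorial q n : ℂ)) := by
    have hcoeff := congrArg Complex.ofReal (one_sub_pow_succ_div_qFactorial_succ hq0 n)
    push_cast at hcoeff
    linear_combination ζ ^ (n + 1) * hcoeff
  rw [← hasSum_nat_add_iff' 1] at hdiff
  simp only [hshift] at hdiff
  have hq := hdiff.unique ((hasSum_qExp hq0 hq1 hζ).mul_left ((1 - q) * ζ))
  simp only [Finset.range_one, Finset.sum_singleton, pow_zero, sub_self, sub_zero] at hq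
  linear_combination hq

theorem qExp_pos (hq0 : 0 ≤ q) (hq1 : q < 1) (hζ : ‖ζ‖ < 1 / (1 - q)) (hζ0 : 0 ≤ ζ) :
    0 < qExp q ζ := by
  have hterm (n : ℕ) : 0 ≤ ζ ^ n / (qFactorial q n : ℂ) :=
    div_nonneg (pow_nonneg hζ0 n) (Complex.zero_le_real.2 (qFactorial_pos hq0 n).le)
  calc (0 : ℂ) < 1 := one_pos
    _ = ζ ^ 0 / (qFactorial q 0 : ℂ) := by simp [qFactorial]
    _ ≤ qExp q ζ := le_hasSum (hasSum_qExp hq0 hq1 hζ) 0 fun n _ ↦ hterm n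

theorem qRadius_pos (hq1 : q < 1) : 0 < qRadius q :=
  one_div_pos.2 (Real.sqrt_pos.2 (sub_pos.2 hq1))

theorem qRadius_sq (hq1 : q < 1) : qRadius q ^ 2 = 1 / (1 - q) := by
  rw [qRadius, div_pow, one_pow, Real.sq_sqrt (sub_nonneg.2 hq1.le)]

theorem qRadius_mul (q : ℝ) (z : ℂ) : (qRadius q : ℂ) * z = z / (√(1 - q) : ℂ) := by
  rw [qRadius, Complex.ofReal_div, Complex.ofReal_one, one_div_mul_eq_div]

theorem norm_mul_conj_lt_one_div (hq1 : q < 1) (z w : Disk (qRadius q)) :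
    ‖(z : ℂ) * conj (w : ℂ)‖ < 1 / (1 - q) :=
  (norm_mul_conj_lt z w).trans_eq (qRadius_sq hq1)

theorem posSemidef_qExp_mul (hq0 : 0 ≤ q) (hq1 : q < 1) :
    (Matrix.of fun z w : Disk (qRadius q) ↦ qExp q (q * ((z : ℂ) * conj (w : ℂ)))).PosSemidef := by
  refine posSemidef_of_posSemidef_scalarKernel (posSemidef_scalarKernel
    (c := fun n ↦ q ^ n / qFactorial q n)
    (fun n ↦ div_nonneg (pow_nonneg hq0 n) (qFactorial_pos hq0 n).le) fun z w ↦ ?_)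
  refine (hasSum_qExp hq0 hq1 (norm_ofReal_mul_lt hq0 hq1
    (norm_mul_conj_lt_one_div hq1 z w))).congr_fun fun n ↦ ?_
  push_cast
  ring

theorem qExp_eq_mul_szegoFun (hq0 : 0 ≤ q) (hq1 : q < 1) (z w : Disk (qRadius q)) :
    qExp q (z * conj (w : ℂ)) =
      qExp q (q * ((z : ℂ) * conj (w : ℂ))) * szegoFun (w / qRadius q) (z / qRadius q) := by
  have hR : (qRadius q : ℂ) ^ 2 = 1 / (1 - q) := by exact_mod_cast qRadius_sq hq1
  have hscale : (z / qRadius q : ℂ) * conj (w / qRadius q : ℂ) =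
      (1 - q) * ((z : ℂ) * conj (w : ℂ)) := by
    rw [map_div₀, Complex.conj_ofReal, div_mul_div_comm, ← sq, hR, div_div_eq_mul_div, div_one,
      mul_comm]
  have hne : 1 - (1 - q) * ((z : ℂ) * conj (w : ℂ)) ≠ 0 := fun h ↦ by
    have hlt := norm_mul_conj_lt
      ⟨z / qRadius q, (div_ofReal_mem_ball_iff (qRadius_pos hq1)).2 z.2⟩
      ⟨w / qRadius q, (div_ofReal_mem_ball_iff (qRadius_pos hq1)).2 w.2⟩
    rw [hscale, ← sub_eq_zero.1 h] at hlt
    simp at hlt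
  rw [← qExp_mul_one_sub hq0 hq1 (norm_mul_conj_lt_one_div hq1 z w), szegoFun, hscale,
    mul_one_div, mul_div_cancel_right₀ _ hne]

end QExp

section HardySpaces

variable (q : Set.Ico (0 : ℝ) 1)

theorem H2q.kernel_apply_one (z w : Disk (qRadius q)) :
    RKHS.kernel (H2q q) z w 1 = qExp q (z * conj (w : ℂ)) := by
  rw [RKHS.OfKernel.kernel_ofKernel, qKernel, scalarKernel_apply_one]

theorem HardyH2.kernel_apply_one (z w : Disk 1) :
    RKHS.kernel HardyH2 z w 1 = szegoFun w z := by
  rw [RKHS.OfKernel.kernel_ofKernel, szegoKernel, scalarKernel_apply_one, szegoFun]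

theorem H2q.kernel_self_pos (z : Disk (qRadius q)) : 0 < RKHS.kernel (H2q q) z z 1 := by
  rw [H2q.kernel_apply_one]
  exact qExp_pos q.2.1 q.2.2 (norm_mul_conj_lt_one_div q.2.2 z z) (mul_star_self_nonneg (z : ℂ))

theorem H2q.isSchurMultiplier_iff {s : ℂ → ℂ} :
    IsSchurMultiplier (H2q q) s ↔ IsSchurFunction fun z ↦ s (qRadius q * z) :=
  isSchurMultiplier_iff_isSchurFunction (qRadius_pos q.2.2) (posSemidef_qExp_mul q.2.1 q.2.2)
    (fun z w ↦ (H2q.kernel_apply_one q z w).trans (qExp_eq_mul_szegoFun q.2.1 q.2.2 z w))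
    (H2q.kernel_self_pos q)

theorem HardyH2.kernel_self_pos (z : Disk 1) : 0 < RKHS.kernel HardyH2 z z 1 := by
  have hz : ‖(z : ℂ)‖ ^ 2 < 1 := by
    simpa using mem_ball_zero_iff.1 z.2
  rw [HardyH2.kernel_apply_one, szegoFun, Complex.mul_conj']
  exact_mod_cast one_div_pos.2 (sub_pos.2 hz)

theorem HardyH2.isSchurMultiplier_iff {σ : ℂ → ℂ} :
    IsSchurMultiplier HardyH2 σ ↔ IsSchurFunction σ := by
  have hD : (Matrix.gram ℂ fun _ : Disk 1 ↦ (1 : ℂ)).PosSemidef := posSemidef_gram _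
  simpa using isSchurMultiplier_iff_isSchurFunction (H := HardyH2) (s := σ) one_pos hD
    (fun z w ↦ (HardyH2.kernel_apply_one z w).trans (by simp [Matrix.gram_apply]))
    HardyH2.kernel_self_pos

end HardySpaces

theorem theorem8p3 (q : Set.Ico (0 : ℝ) 1) :
    (∀ s : ℂ → ℂ, AnalyticOnNhd ℂ s (Metric.ball 0 (1 / √(1 - (q : ℝ)))) →
      (IsContractiveMulOp (H2q q) s ↔
        IsSchurFunction fun z ↦ s (z / (√(1 - (q : ℝ)) : ℂ)))) ∧
    (∀ s : ℂ → ℂ, IsSchurMultiplier (H2q q) s ↔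
      ∃ σ : ℂ → ℂ, IsSchurMultiplier HardyH2 σ ∧
        ∀ z ∈ Metric.ball (0 : ℂ) (1 / √(1 - (q : ℝ))), s z = σ ((√(1 - (q : ℝ)) : ℂ) * z)) := by
  simp only [← qRadius_mul]
  refine ⟨fun s hs ↦ (and_iff_right hs).symm.trans (H2q.isSchurMultiplier_iff q), fun s ↦ ?_⟩
  have hsqrt : (√(1 - (q : ℝ)) : ℂ) ≠ 0 :=
    Complex.ofReal_ne_zero.2 (Real.sqrt_ne_zero'.2 (sub_pos.2 q.2.2))
  simp only [H2q.isSchurMultiplier_iff, HardyH2.isSchurMultiplier_iff]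
  constructor
  · intro h
    exact ⟨_, h, fun z _ ↦ by rw [qRadius_mul, mul_div_cancel_left₀ z hsqrt]⟩
  · rintro ⟨σ, hσ, hsσ⟩
    refine hσ.congr fun z hz ↦ ?_
    rw [hsσ _ ((ofReal_mul_mem_ball_iff (qRadius_pos q.2.2)).2 hz), qRadius_mul,
      mul_div_cancel₀ z hsqrt]
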